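/- **Proposition 3.2.** Topoi are Grothendieck topoi over a fixed universe; a morphism of topoi $f:E\to F$ is given by a functor $f^{-1}:F\to E$ that has a right adjoint and commutes with finite limits, $(f\circ h)^{-1}=h^{-1}\circ f^{-1}$, and two morphisms are identified when their inverse image functors are isomorphic. For an object $X$ of a topos $D$, the object is identified with the topos $D/X$ over $D$, and the restriction of a morphism to $X$ is its composite with $D/X\to D$. A *local isomorphism* $E\to C$ is a morphism of topoi which factors as an equivalence $E\simeq C/Y$ followed by $C/Y\to C$, for some subobject $Y$ of the final object of $C$. Let $C$ be a topos and $G$ a (small) group of automorphisms of $C$ satisfying the principle of analytic continuation: two elements of $G$ whose restrictions to $C/Y$ coincide for some non-initial object $Y$ of $C$ are equal. A *$(C,G)$-structure* on a topos $D$ is given by a family $((X_i)_{i\in I},\varphi_i)$, where $(X_i)$ is a covering family of $D$ (for the canonical topology) by connected objects, each $\varphi_i:D/X_i\to C$ is a local isomorphism, and, for all $i,j$ such that $X_i\times X_j$ is not initial, there is $g_{ij}\in G$ with $g_{ij}\circ\varphi_j=\varphi_i$ on $X_i\times X_j$. (Here an object $X$ is connected if it is not initial and is not covered by two non-initial objects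 $A\to X$, $B\to X$ with $A\times_X B$ initial.) Let $D$ be a topos with a $(C,G)$-structure $((X_i)_{i\in I},\varphi_i)$. Its *structural topos* $S=S((X_i))$ is the topos obtained by gluing the product topoi $(D/X_i)\times C$ along the isomorphisms $(u,c)\mapsto(u,g_{ij}c)$ of $(D/(X_i\times X_j))\times C$. The first projections glue to a projection $p:S\to D$, and the restriction of $S$ to $X_i$ is $(D/X_i)\times C$; let $p_i:(D/X_i)\times C\to C$ be the second projection. A *section* of $S$ is a morphism of topoi $s:D\to S$ together with an isomorphism $p\circ s\simeq\mathrm{Id}_D$; let $s_i:D/X_i\to (D/X_i)\times C$ be its restriction to $X_i$. The section is *transverse* if for every $i$ the morphism $p_i\circ s_i:D/X_i\to C$ is a local isomorphism. If $s$ is a transverse section of $S$, then $((X_i)_{i\in I},\,p_i\circ s_i)$ defines a $(C,G)$-structure on $D$. -/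

import Mathlib

open CategoryTheory CategoryTheory.Limits Opposite

universe u

noncomputable section

namespace GeometricTopos

/-! ### Topoi and their morphisms -/

/-- A Grothendieck topos (relative to the universe `u`): a category equivalent to the category of
sheaves of sets on a small site. -/
class IsTopos (C : Type (u + 1)) [Category.{u} C] : Prop where
  exists_site : ∃ (A : Type u) (_ : SmallCategory A) (J : GrothendieckTopology A),
    Nonempty (C ≌ Sheaf J (Type u))

instance (C : Type (u + 1)) [Category.{u} C] [IsTopos C] : HasFiniteLimits C := by
  obtain ⟨A, _, J, ⟨e⟩⟩ := IsTopos.exists_site (C := C)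
  exact ⟨fun K _ _ => Adjunction.hasLimitsOfShape_of_equivalence e.functor⟩

/-- `F : Y ⥤ X` is the inverse image functor of a morphism of topoi `X → Y`: it has a right adjoint
(the direct image functor) and it commutes with finite limits. A morphism of topoi `f` is represented
by the functor `f⁻¹` throughout; thus `(f ∘ h)⁻¹ = f⁻¹ ⋙ h⁻¹`, and two morphisms coincide if their
inverse image functors are isomorphic. -/
structure IsInverseImage {X Y : Type*} [Category* X] [Category* Y] (F : Y ⥤ X) : Prop where
  isLeftAdjoint : F.IsLeftAdjoint
  preservesFiniteLimits : PreservesFiniteLimits F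

/-- `F : C ⥤ E` is the inverse image functor of a local isomorphism of topoi `E → C`: there is a
subobject `Y` of (the final object of) `C` such that the morphism factors as an isomorphism
(that is, an equivalence) of topoi from `E` to the topos `C / Y`, followed by the canonical morphism
`C / Y → C`, whose inverse image functor is `c ↦ (Y × c → Y)`. -/
def IsLocalIso {C : Type (u + 1)} [Category.{u} C] [IsTopos C] {E : Type*} [Category* E]
    (F : C ⥤ E) : Prop :=
  ∃ (Y : C) (_ : IsSubterminal Y) (e : Over Y ≌ E), Nonempty (F ≅ Over.star Y ⋙ e.functor)

/-- The object `X` of `C` is distinct from the empty (initial) object. -/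
def NonEmptyObj {C : Type (u + 1)} [Category.{u} C] (X : C) : Prop :=
  ¬ Nonempty (IsInitial X)

/-- The object `X` (equivalently, the topos `C / X`) is connected: it is nonempty, and it has no
cover, for the canonical topology, by two nonempty objects `A`, `B` over `X` whose fibre product
over `X` is empty. -/
def IsConnectedObj {C : Type (u + 1)} [Category.{u} C] [IsTopos C] (X : C) : Prop :=
  NonEmptyObj X ∧ ∀ ⦃A B : C⦄ (f : A ⟶ X) (g : B ⟶ X), NonEmptyObj A → NonEmptyObj B →
    Sieve.generate (Presieve.singleton f ⊔ Presieve.singleton g) ∈ Sheaf.canonicalTopology C X →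
    NonEmptyObj (pullback f g)

/-- A small generating family of objects of `C`. -/
structure Generators (C : Type (u + 1)) [Category.{u} C] where
  ι : Type u
  obj : ι → C
  isSeparating : (ObjectProperty.ofObj obj).IsSeparating

/-! ### Groups of automorphisms of a topos and `(C, G)`-structures -/

section Structures

variable {C D : Type (u + 1)} [Category.{u} C] [Category.{u} D]
variable {G : Type u} [Group G] (ρ : G →* Aut (Cat.of C))

/-- The automorphism of the category `C` by which `g : G` acts; on objects it is the direct image
(which is also the image) under the automorphism `g` of the topos. -/
def act (g : G) : C ⥤ C := (ρ g).hom.toFunctor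

/-- The inverse image functor of the automorphism `g` of the topos `C`. -/
abbrev actInv (g : G) : C ⥤ C := act ρ g⁻¹

lemma act_one : act ρ (1 : G) = 𝟭 C := by
  simp only [act, map_one]; rfl

lemma act_mul (g h : G) : act ρ (g * h) = act ρ h ⋙ act ρ g := by
  simp only [act, map_mul]; rfl

/-- Principle of analytic continuation: two elements of `G` which coincide on the topos `C / Y` over
some nonempty object `Y` of `C` are equal. (The restriction of `g` to `C / Y` is the composite
`C / Y → C → C` of the canonical morphism and `g`.) -/
def AnalyticContinuation [IsTopos C] : Prop :=
  ∀ (g h : G) (Y : C), NonEmptyObj Y →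
    Nonempty (actInv ρ g ⋙ Over.star Y ≅ actInv ρ h ⋙ Over.star Y) → g = h

variable [IsTopos D] {I : Type u} {X : I → D} (φ : ∀ i, C ⥤ Over (X i))

/-- For `x : U ⟶ X i` and `y : U ⟶ X j`, this says `g ∘ (φ j)|_U = (φ i)|_U`, where `(φ i)|_U` is the
restriction of `φ i : D / X i → C` along `x`, i.e. its composite with `D / U → D / X i`. -/
def IsTransition {i j : I} {U : D} (x : U ⟶ X i) (y : U ⟶ X j) (g : G) : Prop :=
  Nonempty (actInv ρ g ⋙ φ j ⋙ Over.pullback y ≅ φ i ⋙ Over.pullback x)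

variable (X) in
/-- `(X i, φ i)` defines a `(C, G)`-structure on the topos `D`: the `X i` form a connected covering
family of `D` (for the canonical topology), every chart `φ i : D / X i → C` (given by its inverse
image functor) is a local isomorphism, and whenever `X i × X j` is nonempty there is `g` in `G` with
`g ∘ φ j = φ i` over `X i × X j`. -/
structure IsCGStructure [IsTopos C] : Prop where
  covers : (Sheaf.canonicalTopology D).CoversTop X
  connected : ∀ i, IsConnectedObj (X i)
  isLocalIso : ∀ i, IsLocalIso (φ i)
  transition : ∀ i j, NonEmptyObj (X i ⨯ X j) →
    ∃ g : G, IsTransition ρ φ (prod.fst : X i ⨯ X j ⟶ X i) (prod.snd : X i ⨯ X j ⟶ X j) g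

variable {φ} in
lemma isTransition_one {i : I} {U : D} (x : U ⟶ X i) : IsTransition ρ φ x x 1 := by
  refine ⟨eqToIso ?_⟩
  rw [actInv, inv_one, act_one, Functor.id_comp]

variable {ρ φ} in
lemma IsTransition.mul {i j k : I} {U : D} {x : U ⟶ X i} {y : U ⟶ X j} {z : U ⟶ X k} {g h : G}
    (hg : IsTransition ρ φ x y g) (hh : IsTransition ρ φ y z h) :
    IsTransition ρ φ x z (g * h) := by
  obtain ⟨a⟩ := hg
  obtain ⟨b⟩ := hh
  refine ⟨eqToIso ?_ ≪≫ Functor.isoWhiskerLeft (actInv ρ g) b ≪≫ a⟩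
  rw [actInv, mul_inv_rev, act_mul, Functor.assoc]

variable {ρ φ} in
lemma IsTransition.comp {i j : I} {U V : D} {x : U ⟶ X i} {y : U ⟶ X j} {g : G}
    (hg : IsTransition ρ φ x y g) (v : V ⟶ U) : IsTransition ρ φ (v ≫ x) (v ≫ y) g := by
  obtain ⟨a⟩ := hg
  exact ⟨Functor.isoWhiskerLeft (actInv ρ g ⋙ φ j) (Over.pullbackComp v y) ≪≫
    Functor.isoWhiskerRight a (Over.pullback v) ≪≫
    (Functor.isoWhiskerLeft (φ i) (Over.pullbackComp v x)).symm⟩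

/-! ### The structural topos

The topos `S` is obtained by gluing the product topoi `(D / X i) × C` along the transition maps
`(u, c) ↦ (u, g c)` over `X i × X j`. It is described as the topos of sheaves on the site obtained by
gluing the product sites. -/

/-- The basic objects of the structural topos: `⟨i, U, x, c⟩` stands for the object `(x : U ⟶ X i, c)`
of the product of `D / X i` and `C`. -/
structure ProdObj (ρ : G →* Aut (Cat.of C)) (φ : ∀ i, C ⥤ Over (X i)) where
  idx : I
  base : D
  toX : base ⟶ X idx
  fib : C

namespace ProdObj

variable {ρ φ}

/-- A morphism `(i, U, x, c) ⟶ (j, V, y, d)`: a morphism `u : U ⟶ V` together with a morphism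
`c ⟶ g d`, where `g` is a transition element from the `j`-th to the `i`-th chart over `U`: an object
`d` in the `j`-th copy of `C` is glued with the object `g d` in the `i`-th copy. By analytic
continuation, `g` is determined by `i` and `j` when `U` is nonempty. -/
structure Hom (P Q : ProdObj ρ φ) where
  base : P.base ⟶ Q.base
  elt : G
  isTransition : IsTransition ρ φ P.toX (base ≫ Q.toX) elt
  fib : P.fib ⟶ (act ρ elt).obj Q.fib

lemma Hom.ext_eqToHom {P Q : ProdObj ρ φ} {f g : Hom P Q} (h₁ : f.base = g.base)
    (h₂ : f.elt = g.elt) (h₃ : f.fib ≫ eqToHom (by rw [h₂]) = g.fib) : f = g := by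
  obtain ⟨b, e, t, m⟩ := f
  obtain ⟨b', e', t', m'⟩ := g
  obtain rfl : b = b' := h₁
  obtain rfl : e = e' := h₂
  obtain rfl : m = m' := by simpa using h₃
  rfl

lemma act_one_obj (c : C) : (act ρ (1 : G)).obj c = c := by
  rw [act_one]; rfl

lemma act_mul_obj (g h : G) (c : C) :
    (act ρ (g * h)).obj c = (act ρ g).obj ((act ρ h).obj c) := by
  rw [act_mul]; rfl

lemma act_one_map {c d : C} (f : c ⟶ d) :
    (act ρ (1 : G)).map f = eqToHom (act_one_obj c) ≫ f ≫ eqToHom (act_one_obj d).symm :=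
  Functor.congr_hom (act_one ρ) f

lemma act_mul_map (g h : G) {c d : C} (f : c ⟶ d) :
    (act ρ (g * h)).map f = eqToHom (act_mul_obj g h c) ≫ (act ρ g).map ((act ρ h).map f) ≫
      eqToHom (act_mul_obj g h d).symm :=
  Functor.congr_hom (act_mul ρ g h) f

lemma eqToHom_act {g h : G} (e : g = h) {c d : C} (f : c ⟶ d) :
    eqToHom (by rw [e]) ≫ (act ρ h).map f = (act ρ g).map f ≫ eqToHom (by rw [e]) := by
  subst e; simp

instance : Category.{u} (ProdObj ρ φ) where
  Hom := Hom
  id P :=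
    { base := 𝟙 _
      elt := 1
      isTransition := by simpa using isTransition_one ρ P.toX
      fib := eqToHom (act_one_obj _).symm }
  comp {P Q R} f g :=
    { base := f.base ≫ g.base
      elt := f.elt * g.elt
      isTransition := by
        simpa using f.isTransition.mul (g.isTransition.comp f.base)
      fib := f.fib ≫ (act ρ f.elt).map g.fib ≫ eqToHom (act_mul_obj _ _ _).symm }
  id_comp f := Hom.ext_eqToHom (Category.id_comp _) (one_mul _) (by simp [act_one_map])
  comp_id f := Hom.ext_eqToHom (Category.comp_id _) (mul_one _) (by simp [eqToHom_map])
  assoc f g h := Hom.ext_eqToHom (Category.assoc _ _ _) (mul_assoc _ _ _)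
    (by simp [act_mul_map, eqToHom_map])

@[simp] lemma id_base (P : ProdObj ρ φ) : Hom.base (𝟙 P) = 𝟙 P.base := rfl

@[simp] lemma comp_base {P Q R : ProdObj ρ φ} (f : P ⟶ Q) (g : Q ⟶ R) :
    Hom.base (f ≫ g) = Hom.base f ≫ Hom.base g := rfl

@[simp] lemma id_elt (P : ProdObj ρ φ) : Hom.elt (𝟙 P) = 1 := rfl

@[simp] lemma comp_elt {P Q R : ProdObj ρ φ} (f : P ⟶ Q) (g : Q ⟶ R) :
    Hom.elt (f ≫ g) = Hom.elt f * Hom.elt g := rfl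

@[simp] lemma id_fib (P : ProdObj ρ φ) :
    Hom.fib (𝟙 P) = eqToHom (act_one_obj (ρ := ρ) P.fib).symm := rfl

@[simp] lemma comp_fib {P Q R : ProdObj ρ φ} (f : P ⟶ Q) (g : Q ⟶ R) :
    Hom.fib (f ≫ g) = Hom.fib f ≫ (act ρ (Hom.elt f)).map (Hom.fib g) ≫
      eqToHom (act_mul_obj _ _ _).symm := rfl

variable (ρ φ) in
/-- The projection of the glued products to `D`. -/
@[simps] def toBase : ProdObj ρ φ ⥤ D where
  obj P := P.base
  map f := Hom.base f

variable (ρ φ) in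
/-- The object `X i × c` of the `i`-th product, as a functor of `c`. -/
@[simps] def chartObj (i : I) : C ⥤ ProdObj ρ φ where
  obj c := ⟨i, X i, 𝟙 _, c⟩
  map m :=
    { base := 𝟙 _
      elt := 1
      isTransition := by simpa using isTransition_one ρ (𝟙 (X i))
      fib := m ≫ eqToHom (act_one_obj _).symm }
  map_comp m n := Hom.ext_eqToHom (by simp) (by simp) (by simp [act_one_map])

/-- The sieve on `(i, U, x, c)` induced by a sieve `R` on `U` in `D`: the morphisms whose component
in `D` belongs to `R`. -/
def baseSieve (P : ProdObj ρ φ) (R : Sieve P.base) : Sieve P :=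
  Sieve.functorPullback (toBase ρ φ) (X := P) R

/-- The sieve on `(i, U, x, c)` induced by a sieve `R` on `c` in `C`: the morphisms whose component
`d ⟶ g c` in `C` belongs to the image of `R` under `g`. -/
def fibSieve (P : ProdObj ρ φ) (R : Sieve P.fib) : Sieve P where
  arrows _ f := (R.functorPushforward (act ρ (Hom.elt f))).arrows (Hom.fib f)
  downward_closed := by
    rintro Q Q' f ⟨c, r, m, hr, hf⟩ h
    refine ⟨c, r, Hom.fib h ≫ (act ρ (Hom.elt h)).map m ≫
      eqToHom (act_mul_obj _ _ _).symm, hr, ?_⟩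
    rw [comp_fib, hf]
    simp [act_mul_map]

end ProdObj

/-- The underlying category of the glued site: the objects `(i, U, x, c)` with `U` and `c` in given
small generating families of `D` and `C`. -/
structure GluedSite (ρ : G →* Aut (Cat.of C)) (φ : ∀ i, C ⥤ Over (X i))
    (𝓑 : Generators D) (𝓐 : Generators C) where
  idx : I
  base : 𝓑.ι
  toX : 𝓑.obj base ⟶ X idx
  fib : 𝓐.ι

variable (𝓑 : Generators D) (𝓐 : Generators C)

namespace GluedSite

variable {ρ φ 𝓑 𝓐}

/-- The object of the glued products given by an object of the glued site. -/
def toProdObj (P : GluedSite ρ φ 𝓑 𝓐) : ProdObj ρ φ :=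
  ⟨P.idx, 𝓑.obj P.base, P.toX, 𝓐.obj P.fib⟩

instance : SmallCategory (GluedSite ρ φ 𝓑 𝓐) where
  Hom P Q := P.toProdObj ⟶ Q.toProdObj
  id P := 𝟙 P.toProdObj
  comp f g := CategoryStruct.comp (obj := ProdObj ρ φ) f g
  id_comp f := Category.id_comp (obj := ProdObj ρ φ) f
  comp_id f := Category.comp_id (obj := ProdObj ρ φ) f
  assoc f g h := Category.assoc (obj := ProdObj ρ φ) f g h

variable (ρ φ 𝓑 𝓐) in
/-- The fully faithful functor from the glued site to the glued products. -/
@[simps] def inclusion : GluedSite ρ φ 𝓑 𝓐 ⥤ ProdObj ρ φ where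
  obj P := P.toProdObj
  map f := f

variable (ρ φ 𝓑 𝓐) in
/-- The topology of the glued site, generated by the covers of the first factor in `D` and the covers
of the second factor in `C` (for the canonical topologies of the topoi `D` and `C`). -/
def topology : GrothendieckTopology (GluedSite ρ φ 𝓑 𝓐) :=
  sInf {J | (∀ (P : GluedSite ρ φ 𝓑 𝓐) (R : Sieve (𝓑.obj P.base)),
      R ∈ Sheaf.canonicalTopology D (𝓑.obj P.base) →
        Sieve.functorPullback (inclusion ρ φ 𝓑 𝓐) (X := P) (P.toProdObj.baseSieve R) ∈ J P) ∧
    (∀ (P : GluedSite ρ φ 𝓑 𝓐) (R : Sieve (𝓐.obj P.fib)),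
      R ∈ Sheaf.canonicalTopology C (𝓐.obj P.fib) →
        Sieve.functorPullback (inclusion ρ φ 𝓑 𝓐) (X := P) (P.toProdObj.fibSieve R) ∈ J P)}

end GluedSite

/-- The structural topos `S((X i))` of the `(C, G)`-structure `(X i, φ i)`. -/
abbrev StructuralTopos : Type (u + 1) :=
  Sheaf (GluedSite.topology ρ φ 𝓑 𝓐) (Type u)

instance : IsTopos (StructuralTopos ρ φ 𝓑 𝓐) :=
  ⟨⟨_, _, _, ⟨CategoryTheory.Equivalence.refl⟩⟩⟩

namespace StructuralTopos

/-- The presheaf on the glued site represented by an object `(i, U, x, c)`. -/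
def restrictedYoneda : ProdObj ρ φ ⥤ (GluedSite ρ φ 𝓑 𝓐)ᵒᵖ ⥤ Type u :=
  yoneda ⋙ (Functor.whiskeringLeft _ _ _).obj (GluedSite.inclusion ρ φ 𝓑 𝓐).op

/-- The presheaf `(i, U, x, c) ↦ Hom(U, V)` on the glued site, as a functor of the object `V` of `D`. -/
def basePresheaf : D ⥤ (GluedSite ρ φ 𝓑 𝓐)ᵒᵖ ⥤ Type u :=
  yoneda ⋙ (Functor.whiskeringLeft _ _ _).obj
    (GluedSite.inclusion ρ φ 𝓑 𝓐 ⋙ ProdObj.toBase ρ φ).op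

/-- The projection `p : S → D` (its inverse image functor), induced by the first projections of the
products `(D / X i) × C`. -/
abbrev proj : D ⥤ StructuralTopos ρ φ 𝓑 𝓐 :=
  basePresheaf ρ φ 𝓑 𝓐 ⋙ presheafToSheaf _ _

/-- The morphism from the presheaf represented by `X i × c` to the presheaf given by `X i`. -/
def chartToBase (i : I) (c : C) :
    (restrictedYoneda ρ φ 𝓑 𝓐).obj ((ProdObj.chartObj ρ φ i).obj c) ⟶
      (basePresheaf ρ φ 𝓑 𝓐).obj (X i) :=
  Functor.whiskerLeft (GluedSite.inclusion ρ φ 𝓑 𝓐).op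
    (yonedaMap (ProdObj.toBase ρ φ) ((ProdObj.chartObj ρ φ i).obj c))

lemma chartToBase_naturality (i : I) {c d : C} (m : c ⟶ d) :
    (restrictedYoneda ρ φ 𝓑 𝓐).map ((ProdObj.chartObj ρ φ i).map m) ≫ chartToBase ρ φ 𝓑 𝓐 i d =
      chartToBase ρ φ 𝓑 𝓐 i c := by
  ext P f
  exact Category.comp_id (ProdObj.Hom.base f)

/-- The restriction of `S` to `X i`, that is the topos `S / p⁻¹(X i)`, is the product
`(D / X i) × C`. This is its second projection `p i : (D / X i) × C → C` (its inverse image functor):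
the inverse image of `c` is `X i × c`, regarded as an object over `p⁻¹(X i)`. -/
def sndProj (i : I) : C ⥤ Over ((proj ρ φ 𝓑 𝓐).obj (X i)) where
  obj c := Over.mk ((presheafToSheaf _ _).map (chartToBase ρ φ 𝓑 𝓐 i c))
  map {c d} m := Over.homMk ((presheafToSheaf _ _).map
      ((restrictedYoneda ρ φ 𝓑 𝓐).map ((ProdObj.chartObj ρ φ i).map m))) (by
    exact ((presheafToSheaf _ _).map_comp _ _).symm.trans
      (congrArg _ (chartToBase_naturality ρ φ 𝓑 𝓐 i m)))
  map_id c := by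
    ext1
    simp only [CategoryTheory.Functor.map_id]
    rfl
  map_comp m n := by
    ext1
    simp only [Functor.map_comp]
    rfl

/-- A section of the structural topos: a morphism of topoi `s : D → S` such that `p ∘ s` is the
identity of `D`. -/
structure Section where
  inv : StructuralTopos ρ φ 𝓑 𝓐 ⥤ D
  isInverseImage : IsInverseImage inv
  projIso : proj ρ φ 𝓑 𝓐 ⋙ inv ≅ 𝟭 D

variable {ρ φ 𝓑 𝓐}

/-- The restriction `s i : D / X i → S / p⁻¹(X i) = (D / X i) × C` of a section `s` (its inverse image
functor): an object over `p⁻¹(X i)` is sent to its inverse image by `s`, which is an object over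
`s⁻¹(p⁻¹(X i)) = X i`. -/
def Section.restrict (s : Section ρ φ 𝓑 𝓐) (i : I) :
    Over ((proj ρ φ 𝓑 𝓐).obj (X i)) ⥤ Over (X i) :=
  Over.post s.inv ⋙ Over.map (s.projIso.hom.app (X i))

/-- The morphism of topoi `p i ∘ s i : D / X i → C` (its inverse image functor). -/
def Section.chart (s : Section ρ φ 𝓑 𝓐) (i : I) : C ⥤ Over (X i) :=
  sndProj ρ φ 𝓑 𝓐 i ⋙ s.restrict i

/-- A section `s` is transverse if every `p i ∘ s i` is a local isomorphism. -/
def Section.IsTransverse [IsTopos C] (s : Section ρ φ 𝓑 𝓐) : Prop :=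
  ∀ i, IsLocalIso (s.chart i)

end StructuralTopos

end Structures

end GeometricTopos

end

noncomputable section

namespace GeometricTopos

section Structures

variable {C D : Type (u + 1)} [Category.{u} C] [Category.{u} D] {G : Type u} [Group G]
  {ρ : G →* Aut (Cat.of C)} [IsTopos D] {I : Type u} {X : I → D} {φ : ∀ i, C ⥤ Over (X i)}

/-! The group elements of the given structure also serve for the charts p_i ∘ s_i. Let g be a
transition element from chart j to chart i over U, along x : U ⟶ X i and y : U ⟶ X j. In S the
object (x, c) of the i-th product is glued to (y, g⁻¹c), so its map to X j × g⁻¹c is cartesian over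
y (`exists_comp_eq`, `eq_of_comp_eq`).

The associated sheaf functor and s⁻¹ preserve finite limits, and p ∘ s ≅ Id identifies the base of
the resulting square with y (`isPullback_invObj`). Hence s⁻¹(x, c) is the pullback along y of the
j-th new chart at g⁻¹c, naturally in c (`chartOverIso`). Since s⁻¹(x, c) involves neither j, y nor
g, comparison with the case j = i, y = x, g = 1 shows that g is a transition element for the new
charts (`IsTransition.chart`). The covering family is unchanged, and transversality supplies the
local isomorphisms. -/

lemma IsTransition.symm {i j : I} {U : D} {x : U ⟶ X i} {y : U ⟶ X j} {g : G}
    (hg : IsTransition ρ φ x y g) : IsTransition ρ φ y x g⁻¹ := by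
  obtain ⟨a⟩ := hg
  refine ⟨Functor.isoWhiskerLeft (actInv ρ g⁻¹) a.symm ≪≫ eqToIso ?_⟩
  rw [← Functor.assoc, actInv, actInv, ← act_mul, inv_inv, inv_mul_cancel, act_one,
    Functor.id_comp]

/-! ### Cartesian morphisms and change of charts in the glued products -/

namespace ProdObj

/-- A morphism of the glued products whose component in `C` is an isomorphism is cartesian over its
component in `D`: existence of lifts. -/
lemma exists_comp_eq {P Q W : ProdObj ρ φ} (f : P ⟶ Q) [IsIso (Hom.fib f)] (h : W ⟶ Q)
    (v : W.base ⟶ P.base) (hv : Hom.base h = v ≫ Hom.base f) :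
    ∃ k : W ⟶ P, k ≫ f = h ∧ Hom.base k = v := by
  obtain ⟨b, e, t, m⟩ := h
  obtain rfl : b = v ≫ Hom.base f := hv
  -- Group components multiply under composition, so that of the lift is forced.
  obtain ⟨g, rfl⟩ : ∃ g, e = g * Hom.elt f := ⟨e * (Hom.elt f)⁻¹, by simp⟩
  -- Compose the transition carried by `h` with the inverse of the one carried by `f`, restricted
  -- along `v`.
  have t' : IsTransition ρ φ W.toX (v ≫ P.toX) g := by
    have := t.mul (by simpa using ((Hom.isTransition f).comp v).symm)
    rwa [mul_inv_cancel_right] at this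
  refine ⟨⟨v, g, t', m ≫ eqToHom (act_mul_obj _ _ _) ≫ (act ρ g).map (inv (Hom.fib f))⟩, ?_, rfl⟩
  refine Hom.ext_eqToHom rfl rfl ?_
  rw [comp_fib]
  simp only [Category.assoc, eqToHom_refl, Category.comp_id]
  rw [← Functor.map_comp_assoc, IsIso.inv_hom_id, CategoryTheory.Functor.map_id, Category.id_comp,
    eqToHom_trans, eqToHom_refl, Category.comp_id]

/-- A morphism of the glued products whose component in `C` is an isomorphism is cartesian over its
component in `D`: uniqueness of lifts. -/
lemma eq_of_comp_eq {P Q W : ProdObj ρ φ} (f : P ⟶ Q) [IsIso (Hom.fib f)] {k l : W ⟶ P}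
    (h : k ≫ f = l ≫ f) (hb : Hom.base k = Hom.base l) : k = l := by
  have he : Hom.elt k = Hom.elt l := mul_right_cancel (congrArg Hom.elt h)
  obtain ⟨b, e, t, m⟩ := k
  obtain ⟨b', e', t', m'⟩ := l
  obtain rfl : b = b' := hb
  obtain rfl : e = e' := he
  have hm : m ≫ (act ρ e).map (Hom.fib f) ≫ eqToHom (act_mul_obj _ _ _).symm =
      m' ≫ (act ρ e).map (Hom.fib f) ≫ eqToHom (act_mul_obj _ _ _).symm := by
    injection h with _ _ h₃
  obtain rfl : m = m' := by simpa [cancel_mono] using hm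
  rfl

variable (ρ φ) in
/-- The object `(x : U ⟶ X i, c)` of the `i`-th product, as a functor of `c`. -/
@[simps] def objOver {i : I} {U : D} (x : U ⟶ X i) : C ⥤ ProdObj ρ φ where
  obj c := ⟨i, U, x, c⟩
  map m :=
    { base := 𝟙 _
      elt := 1
      isTransition := by simpa using isTransition_one ρ x
      fib := m ≫ eqToHom (act_one_obj _).symm }
  map_comp m n := Hom.ext_eqToHom (by simp) (by simp) (by simp [act_one_map])

lemma act_act_inv_obj (g : G) (c : C) : (act ρ g).obj ((actInv ρ g).obj c) = c := by
  rw [actInv, ← act_mul_obj, mul_inv_cancel, act_one_obj]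

lemma act_act_inv_map (g : G) {c d : C} (m : c ⟶ d) :
    (act ρ g).map ((actInv ρ g).map m) =
      eqToHom (act_act_inv_obj g c) ≫ m ≫ eqToHom (act_act_inv_obj g d).symm := by
  have h : actInv ρ g ⋙ act ρ g = 𝟭 C := by
    rw [actInv, ← act_mul, mul_inv_cancel, act_one]
  exact Functor.congr_hom h m

/-- The change of charts: the object `(x : U ⟶ X i, c)` of the `i`-th product maps to `X j × g⁻¹ c`
along `y : U ⟶ X j`, if `g` is a transition element from the `j`-th to the `i`-th chart over `U`. -/
@[simps app] def toChartObj {i j : I} {U : D} {x : U ⟶ X i} {y : U ⟶ X j} {g : G}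
    (hg : IsTransition ρ φ x y g) : objOver ρ φ x ⟶ actInv ρ g ⋙ chartObj ρ φ j where
  app c :=
    { base := y
      elt := g
      isTransition := by
        change IsTransition ρ φ x (y ≫ 𝟙 _) g
        rwa [Category.comp_id]
      fib := eqToHom (act_act_inv_obj g c).symm }
  naturality c d m := by
    -- Both composites have base `y` and group element `g`; only the components in `C` remain to be
    -- compared.
    refine Hom.ext_eqToHom ((Category.id_comp y).trans (Category.comp_id y).symm)
      ((one_mul g).trans (mul_one g).symm) ?_
    change ((m ≫ eqToHom (act_one_obj d).symm) ≫
        (act ρ 1).map (eqToHom (act_act_inv_obj g d).symm) ≫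
          eqToHom (act_mul_obj 1 g ((actInv ρ g).obj d)).symm) ≫
        eqToHom (by rw [one_mul, mul_one]) =
      eqToHom (act_act_inv_obj g c).symm ≫
        (act ρ g).map ((actInv ρ g).map m ≫ eqToHom (act_one_obj ((actInv ρ g).obj d)).symm) ≫
          eqToHom (act_mul_obj g 1 ((actInv ρ g).obj d)).symm
    simp [act_act_inv_map, eqToHom_map]

end ProdObj

variable {𝓑 : Generators D} {𝓐 : Generators C}

/-! ### Pullback squares in the structural topos and along a section -/

namespace StructuralTopos

variable (ρ φ 𝓑 𝓐) in
/-- The morphism from the presheaf represented by `(i, U, x, c)` to the presheaf given by `U`. -/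
@[simps] def restrictedYonedaToBase :
    restrictedYoneda ρ φ 𝓑 𝓐 ⟶ ProdObj.toBase ρ φ ⋙ basePresheaf ρ φ 𝓑 𝓐 where
  app P := Functor.whiskerLeft (GluedSite.inclusion ρ φ 𝓑 𝓐).op
    (yonedaMap (ProdObj.toBase ρ φ) P)

/-- Evaluated at an object of the glued site, this is the unique lifting property of a cartesian
morphism. -/
lemma isPullback_restrictedYoneda {P Q : ProdObj ρ φ} (f : P ⟶ Q) [IsIso (ProdObj.Hom.fib f)] :
    IsPullback ((restrictedYoneda ρ φ 𝓑 𝓐).map f) ((restrictedYonedaToBase ρ φ 𝓑 𝓐).app P)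
      ((restrictedYonedaToBase ρ φ 𝓑 𝓐).app Q)
      ((basePresheaf ρ φ 𝓑 𝓐).map (ProdObj.Hom.base f)) := by
  refine IsPullback.of_forall_isPullback_app fun W => ?_
  rw [Types.isPullback_iff]
  refine ⟨congrArg (fun α => NatTrans.app α W) ((restrictedYonedaToBase ρ φ 𝓑 𝓐).naturality f),
    fun k l h => ProdObj.eq_of_comp_eq f h.1 h.2,
    fun h v hv => ProdObj.exists_comp_eq f h v hv⟩

namespace Section

variable (s : Section ρ φ 𝓑 𝓐)

/-- The inverse image under a section of the sheaf associated with the presheaf represented by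
`(i, U, x, c)`. -/
abbrev invObj : ProdObj ρ φ ⥤ D :=
  restrictedYoneda ρ φ 𝓑 𝓐 ⋙ presheafToSheaf _ _ ⋙ s.inv

/-- The inverse image under a section of `(i, U, x, c)` lies over `U`. -/
def invObjToBase : s.invObj ⟶ ProdObj.toBase ρ φ :=
  Functor.whiskerRight (restrictedYonedaToBase ρ φ 𝓑 𝓐) (presheafToSheaf _ _ ⋙ s.inv) ≫
    Functor.whiskerLeft (ProdObj.toBase ρ φ) s.projIso.hom

/-- Two squares are pasted: the image of the presheaf pullback under a functor preserving finite
limits, and the naturality square of p ∘ s ≅ Id, whose vertical sides are isomorphisms. -/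
lemma isPullback_invObj {P Q : ProdObj ρ φ} (f : P ⟶ Q) [IsIso (ProdObj.Hom.fib f)] :
    IsPullback (s.invObj.map f) (s.invObjToBase.app P) (s.invObjToBase.app Q)
      (ProdObj.Hom.base f) := by
  have := s.isInverseImage.preservesFiniteLimits
  have h := (isPullback_restrictedYoneda (𝓑 := 𝓑) (𝓐 := 𝓐) f).map (presheafToSheaf _ _ ⋙ s.inv)
  have h' : IsPullback (s.inv.map ((proj ρ φ 𝓑 𝓐).map (ProdObj.Hom.base f)))
      (s.projIso.hom.app P.base) (s.projIso.hom.app Q.base) (ProdObj.Hom.base f) :=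
    IsPullback.of_vert_isIso ⟨s.projIso.hom.naturality (ProdObj.Hom.base f)⟩
  exact h.paste_vert h'

/-- The restriction of the chart of index `i` of a section along `x : U ⟶ X i`. -/
def chartOver {i : I} {U : D} (x : U ⟶ X i) : C ⥤ Over U where
  obj c := Over.mk (s.invObjToBase.app ((ProdObj.objOver ρ φ x).obj c))
  map m := Over.homMk (s.invObj.map ((ProdObj.objOver ρ φ x).map m))
    ((s.invObjToBase.naturality _).trans (Category.comp_id _))
  map_id c := by
    ext
    exact (congrArg s.invObj.map ((ProdObj.objOver ρ φ x).map_id c)).trans (s.invObj.map_id _)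
  map_comp m n := by
    ext
    exact (congrArg s.invObj.map ((ProdObj.objOver ρ φ x).map_comp m n)).trans
      (s.invObj.map_comp _ _)

/-- The pullback of a chart of a section can be computed in any chart of the given structure. -/
def chartOverIso {i j : I} {U : D} {x : U ⟶ X i} {y : U ⟶ X j} {g : G}
    (hg : IsTransition ρ φ x y g) : s.chartOver x ≅ actInv ρ g ⋙ s.chart j ⋙ Over.pullback y :=
  have (c : C) : IsIso (ProdObj.Hom.fib ((ProdObj.toChartObj hg).app c)) :=
    inferInstanceAs (IsIso (eqToHom (ProdObj.act_act_inv_obj g c).symm))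
  have h (c : C) := s.isPullback_invObj ((ProdObj.toChartObj hg).app c)
  NatIso.ofComponents (fun c => Over.isoMk (h c).isoPullback (h c).isoPullback_hom_snd)
    (fun {c d} m => by
      ext
      refine pullback.hom_ext ?_ ?_
      -- On the projection to the j-th chart, this is naturality of the change of charts.
      · have hm : s.invObj.map ((ProdObj.objOver ρ φ x).map m) ≫
            s.invObj.map ((ProdObj.toChartObj hg).app d) =
            s.invObj.map ((ProdObj.toChartObj hg).app c) ≫
              s.invObj.map ((ProdObj.chartObj ρ φ j).map ((actInv ρ g).map m)) := by
          rw [← Functor.map_comp, ← Functor.map_comp]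
          exact congrArg s.invObj.map ((ProdObj.toChartObj hg).naturality m)
        calc
          _ = s.invObj.map ((ProdObj.objOver ρ φ x).map m) ≫ (h d).isoPullback.hom ≫
              pullback.fst _ _ := Category.assoc _ _ _
          _ = _ := (whisker_eq _ (h d).isoPullback_hom_fst).trans hm
          _ = (h c).isoPullback.hom ≫ pullback.fst _ _ ≫
              s.invObj.map ((ProdObj.chartObj ρ φ j).map ((actInv ρ g).map m)) :=
            ((h c).isoPullback_hom_fst_assoc _).symm
          _ = _ := (whisker_eq _ (pullback.lift_fst _ _ _).symm).trans
            (Category.assoc _ _ _).symm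
      -- On the projection to `U`, both sides are the structure map, since `m` acts over the
      -- identity of `U`.
      · have hm : s.invObj.map ((ProdObj.objOver ρ φ x).map m) ≫ s.invObjToBase.app _ =
            s.invObjToBase.app _ := Over.w ((s.chartOver x).map m)
        exact (Category.assoc _ _ _).trans <| (whisker_eq _ (h d).isoPullback_hom_snd).trans <|
          hm.trans <| (h c).isoPullback_hom_snd.symm.trans <|
            (whisker_eq _ (pullback.lift_snd _ _ _).symm).trans (Category.assoc _ _ _).symm)

end Section

end StructuralTopos

/-- A transition element for the charts of a structure is a transition element for the charts of any
section of its structural topos. -/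
lemma IsTransition.chart (s : StructuralTopos.Section ρ φ 𝓑 𝓐) {i j : I} {U : D} {x : U ⟶ X i}
    {y : U ⟶ X j} {g : G} (hg : IsTransition ρ φ x y g) : IsTransition ρ s.chart x y g := by
  -- `a` only removes the action of 1, which is left over when `chartOverIso` is applied with j = i
  -- and g = 1.
  obtain ⟨a⟩ : IsTransition ρ s.chart x x 1 := isTransition_one ρ x
  exact ⟨(s.chartOverIso hg).symm ≪≫ s.chartOverIso (isTransition_one ρ x) ≪≫ a⟩

end Structures

end GeometricTopos

end

theorem proposition3p2 {C D : Type (u + 1)} [Category.{u} C] [Category.{u} D]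
    [GeometricTopos.IsTopos C] [GeometricTopos.IsTopos D]
    {G : Type u} [Group G] (ρ : G →* Aut (Cat.of C)) (hρ : Function.Injective ρ)
    (hG : GeometricTopos.AnalyticContinuation ρ)
    {I : Type u} (X : I → D) (φ : ∀ i, C ⥤ Over (X i))
    (hφ : GeometricTopos.IsCGStructure ρ X φ)
    (𝓑 : GeometricTopos.Generators D) (𝓐 : GeometricTopos.Generators C)
    (s : GeometricTopos.StructuralTopos.Section ρ φ 𝓑 𝓐) (hs : s.IsTransverse) :
    GeometricTopos.IsCGStructure ρ X s.chart where
  covers := hφ.covers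
  connected := hφ.connected
  isLocalIso := hs
  transition i j hij := by
    obtain ⟨g, hg⟩ := hφ.transition i j hij
    exact ⟨g, hg.chart s⟩
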